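/- Let $X$ be a real Banach space, let $A$ be a (possibly unbounded) linear operator on $X$ and let $B$ be a bounded linear operator on $X$. For $y\in X$ let $J(y)=\{\phi\in X^*:\ \langle y,\phi\rangle=\|y\|^2=\|\phi\|^2\}$ be the duality map. Assume: ($\mathcal A_1$) $A$ generates a linear $C_0$-semigroup $(S(t))_{t\ge 0}$ of contractions on $X$. ($\mathcal A_2$) The map $B_J:y\mapsto\langle By,J(y)\rangle$ is single-valued (that is, $\langle By,\phi\rangle$ has the same value, denoted $\langle By,J(y)\rangle$, for all $\phi\in J(y)$) and satisfies $|B_J(y)-B_J(z)|\le \mathcal K(\|y\|,\|z\|)\,\|y-z\|$ for all $y,z\in X$, where $\mathcal K:[0,\infty)^2\to[0,\infty)$ is nondecreasing in both arguments, $s\mapsto\mathcal K(s,s)$ is continuous, and $\mathcal K(s,s)\le Cs$ for all $s\ge0$, for some constant $C>0$. ($\mathcal A_3$) There are $T,\delta>0$ such that $\int_0^T|\langle BS(t)y,J(S(t)y)\rangle|\,dt\ge\delta\|S(T)y\|^2$ for all $y\in X$. For $\lambda>0$ consider the system $\dot z(t)=Az(t)+u(t)Bz(t)$, $z(0)=z_0$,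 closed with the feedback control $$u(t)=-\lambda\,\frac{\langle Bz(t),J(z(t))\rangle}{\|z(t)\|^2}\ \text{ if } z(t)\ne0,\qquad u(t)=0\ \text{ if } z(t)=0 .$$ Put $$K_\lambda=e^{\lambda\|B\|^2T}-1,\qquad C_1=(1+C\|B\|)\sqrt T,\qquad \zeta=\frac{1+\frac{\lambda\delta^2}{4C_1^2}K_\lambda}{1+\frac{\lambda\delta^2}{4C_1^2}} .$$ Then there is $\lambda_0>0$ such that for every $\lambda\in(0,\lambda_0)$ the control ensures uniform exponential stabilization: $\zeta\in(0,1)$, and for every $z_0\in X$ the closed-loop system has a unique global mild solution $z$, that is, a unique continuous $z:[0,\infty)\to X$ with $z(t)=S(t)z_0+\int_0^tu(s)S(t-s)Bz(s)\,ds$ for all $t\ge0$, and it satisfies $$\|z(t)\|\le Me^{-\sigma t}\|z_0\|\quad(t\ge0),\qquad M=\zeta^{-1/4}>0,\qquad \sigma=\frac{-\ln\zeta}{4T}>0 .$$ -/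

import Mathlib

open Filter Topology Set
open scoped NNReal

namespace BilinearStabilization

noncomputable section

/-- `S` (only its values at times `t ≥ 0` matter) is a `C₀`-semigroup of bounded linear operators
on `X`. -/
structure IsC0Semigroup {X : Type*} [NormedAddCommGroup X] [NormedSpace ℝ X]
    (S : ℝ → X →L[ℝ] X) : Prop where
  zero : S 0 = ContinuousLinearMap.id ℝ X
  add : ∀ s t : ℝ, 0 ≤ s → 0 ≤ t → S (s + t) = (S s).comp (S t)
  tendsto_zero : ∀ x : X, Tendsto (fun t => S t x) (𝓝[>] 0) (𝓝 x)

/-- The (possibly unbounded) operator `A` is the infinitesimal generator of `S`: `x` lies in the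
domain of `A` and `A x = y` iff `(S h x - x) / h → y` as `h → 0⁺`. -/
def IsGenerator {X : Type*} [NormedAddCommGroup X] [NormedSpace ℝ X]
    (A : X →ₗ.[ℝ] X) (S : ℝ → X →L[ℝ] X) : Prop :=
  ∀ x y : X, (x, y) ∈ A.graph ↔
    Tendsto (fun h : ℝ => h⁻¹ • (S h x - x)) (𝓝[>] 0) (𝓝 y)

/-- `A` generates the `C₀`-semigroup `S`, and `S` is a semigroup of contractions. -/
structure GeneratesContractionSemigroup {X : Type*} [NormedAddCommGroup X] [NormedSpace ℝ X]
    (A : X →ₗ.[ℝ] X) (S : ℝ → X →L[ℝ] X) : Prop where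
  semigroup : IsC0Semigroup S
  generator : IsGenerator A S
  contraction : ∀ t : ℝ, 0 ≤ t → ∀ x : X, ‖S t x‖ ≤ ‖x‖

/-- The (multi-valued) duality map `J : X → X*`. -/
def dualityMap {X : Type*} [NormedAddCommGroup X] [NormedSpace ℝ X] (y : X) :
    Set (StrongDual ℝ X) :=
  {φ | φ y = ‖y‖ ^ 2 ∧ ‖φ‖ ^ 2 = ‖y‖ ^ 2}

theorem dualityMap_nonempty {X : Type*} [NormedAddCommGroup X] [NormedSpace ℝ X] (y : X) :
    (dualityMap y).Nonempty := by
  obtain ⟨g, hg1, hgy⟩ := exists_dual_vector'' ℝ y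
  have hgy' : g y = ‖y‖ := by simpa using hgy
  refine ⟨‖y‖ • g, ?_, ?_⟩
  · simp [hgy', sq]
  · rw [norm_smul, norm_norm]
    by_cases h : ‖y‖ = 0
    · simp [h]
    · have h1 : 1 ≤ ‖g‖ := by
        have hle := g.le_opNorm y
        rw [hgy', norm_norm] at hle
        have hpos : 0 < ‖y‖ := lt_of_le_of_ne (norm_nonneg y) (Ne.symm h)
        nlinarith
      rw [le_antisymm hg1 h1, mul_one]

/-- The map `B_J : y ↦ ⟨B y, J y⟩` is single-valued: `⟨B y, φ⟩` is the same for all `φ ∈ J y`. -/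
def PairingSingleValued {X : Type*} [NormedAddCommGroup X] [NormedSpace ℝ X]
    (B : X →L[ℝ] X) : Prop :=
  ∀ y : X, ∀ φ ∈ dualityMap y, ∀ ψ ∈ dualityMap y, φ (B y) = ψ (B y)

/-- `⟨B y, J y⟩`: the value of `⟨B y, φ⟩` at a selected `φ ∈ J y`. When `B_J` is single-valued this
is the value at every `φ ∈ J y`, see `pairing_eq`. -/
def pairing {X : Type*} [NormedAddCommGroup X] [NormedSpace ℝ X]
    (B : X →L[ℝ] X) (y : X) : ℝ :=
  (dualityMap_nonempty y).choose (B y)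

theorem pairing_eq {X : Type*} [NormedAddCommGroup X] [NormedSpace ℝ X]
    {B : X →L[ℝ] X} (hB : PairingSingleValued B) {y : X} {φ : StrongDual ℝ X}
    (hφ : φ ∈ dualityMap y) : pairing B y = φ (B y) :=
  hB y _ (dualityMap_nonempty y).choose_spec φ hφ

/-- `B_J` is single-valued and Lipschitz with modulus `𝒦(‖y‖, ‖z‖)`, where `𝒦` is increasing in
both arguments, and `s ↦ 𝒦(s, s)` is continuous and bounded by `C s` for a constant `C > 0`. -/
structure PairingLipschitz {X : Type*} [NormedAddCommGroup X] [NormedSpace ℝ X]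
    (B : X →L[ℝ] X) (𝒦 : ℝ≥0 → ℝ≥0 → ℝ≥0) (C : ℝ) : Prop where
  singleValued : PairingSingleValued B
  lipschitz : ∀ y z : X, |pairing B y - pairing B z| ≤ (𝒦 ‖y‖₊ ‖z‖₊ : ℝ) * ‖y - z‖
  mono : ∀ s₁ s₂ r₁ r₂ : ℝ≥0, s₁ ≤ r₁ → s₂ ≤ r₂ → 𝒦 s₁ s₂ ≤ 𝒦 r₁ r₂
  continuous_diag : Continuous fun s : ℝ≥0 => 𝒦 s s
  pos : 0 < C
  diag_le : ∀ s : ℝ≥0, (𝒦 s s : ℝ) ≤ C * s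

/-- The observation estimate `∫₀ᵀ |⟨B S(t) y, J (S(t) y)⟩| dt ≥ δ ‖S(T) y‖²` for all `y`. -/
structure Observation {X : Type*} [NormedAddCommGroup X] [NormedSpace ℝ X]
    (S : ℝ → X →L[ℝ] X) (B : X →L[ℝ] X) (T δ : ℝ) : Prop where
  pos_T : 0 < T
  pos_δ : 0 < δ
  estimate : ∀ y : X, δ * ‖S T y‖ ^ 2 ≤ ∫ t in (0 : ℝ)..T, |pairing B (S t y)|

open Classical in
/-- The normalized feedback law `- lam ⟨B z, J z⟩ / ‖z‖²`, set to `0` at `z = 0`. -/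
def feedback {X : Type*} [NormedAddCommGroup X] [NormedSpace ℝ X]
    (B : X →L[ℝ] X) (lam : ℝ) (z : X) : ℝ :=
  if z = 0 then 0 else -lam * pairing B z / ‖z‖ ^ 2

/-- `z` is a (global) mild solution of `z' = A z + u(t) B z`, `z 0 = z₀`, where `S` is the semigroup
generated by `A`: it is continuous on `[0, ∞)` and satisfies the variation of constants formula. -/
structure IsMildSolution {X : Type*} [NormedAddCommGroup X] [NormedSpace ℝ X]
    (S : ℝ → X →L[ℝ] X) (B : X →L[ℝ] X) (u : ℝ → ℝ) (z₀ : X) (z : ℝ → X) : Prop where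
  continuousOn : ContinuousOn z (Ici 0)
  integrable : ∀ t : ℝ, 0 ≤ t →
    IntervalIntegrable (fun s => u s • S (t - s) (B (z s))) MeasureTheory.volume 0 t
  formula : ∀ t : ℝ, 0 ≤ t →
    z t = S t z₀ + ∫ s in (0 : ℝ)..t, u s • S (t - s) (B (z s))

/-- `z` is a mild solution of the system closed with the feedback law `V`, i.e. with the control
`u(t) = V (z t)`. -/
def IsClosedLoopSolution {X : Type*} [NormedAddCommGroup X] [NormedSpace ℝ X]
    (S : ℝ → X →L[ℝ] X) (B : X →L[ℝ] X) (V : X → ℝ) (z₀ : X) (z : ℝ → X) : Prop :=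
  IsMildSolution S B (fun t => V (z t)) z₀ z

/-- The feedback law `V` uniformly exponentially stabilizes the system with the constants `M` and
`σ`: every initial state has a unique global mild solution of the closed-loop system, and that
solution satisfies `‖z t‖ ≤ M e^{-σ t} ‖z₀‖`. -/
def UniformlyExponentiallyStabilizes {X : Type*} [NormedAddCommGroup X] [NormedSpace ℝ X]
    (S : ℝ → X →L[ℝ] X) (B : X →L[ℝ] X) (V : X → ℝ) (M σ : ℝ) : Prop :=
  0 < M ∧ 0 < σ ∧ ∀ z₀ : X,
    (∃ z : ℝ → X, IsClosedLoopSolution S B V z₀ z) ∧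
    (∀ z w : ℝ → X, IsClosedLoopSolution S B V z₀ z → IsClosedLoopSolution S B V z₀ w →
      EqOn z w (Ici 0)) ∧
    (∀ z : ℝ → X, IsClosedLoopSolution S B V z₀ z →
      ∀ t : ℝ, 0 ≤ t → ‖z t‖ ≤ M * Real.exp (-σ * t) * ‖z₀‖)

/-- `K_lam = e^{lam b² T} - 1`, with `b = ‖B‖`. -/
def gainConst (b T lam : ℝ) : ℝ :=
  Real.exp (lam * b ^ 2 * T) - 1

/-- `C₁ = (1 + C b) √T`, with `b = ‖B‖`. -/
def obsConst (b C T : ℝ) : ℝ :=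
  (1 + C * b) * Real.sqrt T

/-- `ζ = (1 + κ K_lam) / (1 + κ)` with `κ = lam δ² / (4 C₁²)`. -/
def decayRatio (b C T δ lam : ℝ) : ℝ :=
  (1 + lam * δ ^ 2 / (4 * obsConst b C T ^ 2) * gainConst b T lam) /
    (1 + lam * δ ^ 2 / (4 * obsConst b C T ^ 2))

end

end BilinearStabilization

namespace BilinearStabilization

variable {X : Type*} [NormedAddCommGroup X] [NormedSpace ℝ X]

/-! The feedback dissipates energy at the rate at which the control acts, and the observation
estimate turns that dissipation into decay over one period. Write `N(y) = |⟨By, J y⟩| / ‖y‖`.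
Although `u` may jump at `0`, the field `y ↦ u(y) B y` is globally Lipschitz
(`exists_lipschitzWith`), so mild solutions exist globally and are unique. Since `u ⟨Bz, J z⟩ = -λ
N(z)²` and `S` contracts, `‖z(t)‖² ≤ ‖z₀‖² - 2λ ∫₀ᵗ N(z)²` (`norm_sq_le`). The solution stays within
`λ‖B‖ ∫₀ᵀ N(z)` of the free orbit `S(t) z₀`, so the observation estimate passes from the free orbit
to `z`. With Cauchy-Schwarz, `δ² ‖S(T) z₀‖⁴ ≤ C₁² ‖z₀‖² ∫₀ᵀ N(z)²`, that is, `8κ ‖S(T) z₀‖⁴ ≤ ‖z₀‖⁴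
- ‖z(T)‖⁴` with `κ = λδ²/(4C₁²)`. For small `λ`, closeness of `z(T)` to `S(T) z₀` also gives
`‖z(T)‖⁴ ≤ 8 ‖S(T) z₀‖⁴ + K_λ ‖z₀‖⁴`. Eliminating `S(T) z₀` yields `‖z(T)‖⁴ ≤ ζ ‖z₀‖⁴`
(`norm_pow_four_le`), which is iterated over periods. -/

/-- `S` is a `C₀`-semigroup of contractions. -/
structure IsContractionSemigroup (S : ℝ → X →L[ℝ] X) : Prop where
  semigroup : IsC0Semigroup S
  contraction : ∀ t : ℝ, 0 ≤ t → ∀ x : X, ‖S t x‖ ≤ ‖x‖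

/-! ### Joint continuity of a contraction semigroup -/

namespace IsContractionSemigroup

variable {S : ℝ → X →L[ℝ] X}

theorem zero_apply (hS : IsContractionSemigroup S) (x : X) : S 0 x = x := by
  simp [hS.semigroup.zero]

theorem add_apply (hS : IsContractionSemigroup S) {s t : ℝ} (hs : 0 ≤ s) (ht : 0 ≤ t) (x : X) :
    S (s + t) x = S s (S t x) := by
  simp [hS.semigroup.add s t hs ht]

theorem tendsto_abs (hS : IsContractionSemigroup S) (x : X) :
    Tendsto (fun t : ℝ => S |t| x) (𝓝 0) (𝓝 x) := by
  have h1 : ContinuousWithinAt (fun t => S t x) (Ici 0) 0 := by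
    rw [← Ioi_insert, continuousWithinAt_insert_self]
    simpa [ContinuousWithinAt, hS.zero_apply] using hS.semigroup.tendsto_zero x
  have h2 : Tendsto (fun t : ℝ => |t|) (𝓝 0) (𝓝[Ici 0] 0) :=
    tendsto_nhdsWithin_iff.2 ⟨by simpa using (continuous_abs.tendsto (0 : ℝ)),
      Eventually.of_forall fun t => abs_nonneg t⟩
  simpa [hS.zero_apply, Function.comp_def] using h1.tendsto.comp h2

theorem norm_sub_le (hS : IsContractionSemigroup S) {s t : ℝ} (hs : 0 ≤ s) (ht : 0 ≤ t) (x : X) :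
    ‖S s x - S t x‖ ≤ ‖S |s - t| x - x‖ := by
  wlog h : t ≤ s generalizing s t
  · rw [norm_sub_rev, abs_sub_comm]
    exact this ht hs (le_of_not_ge h)
  · have : S s x = S t (S (s - t) x) := by
      rw [← hS.add_apply ht (sub_nonneg.2 h), add_sub_cancel]
    rw [this, ← map_sub, abs_of_nonneg (sub_nonneg.2 h)]
    exact hS.contraction t ht _

theorem continuous_uncurry (hS : IsContractionSemigroup S) :
    Continuous fun q : ℝ × X => S (max q.1 0) q.2 := by
  rw [continuous_iff_continuousAt]
  rintro ⟨t, x⟩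
  rw [ContinuousAt, tendsto_iff_norm_sub_tendsto_zero]
  have hb : ∀ q : ℝ × X, ‖S (max q.1 0) q.2 - S (max t 0) x‖ ≤
      ‖q.2 - x‖ + ‖S |max q.1 0 - max t 0| x - x‖ := fun q => by
    calc _ = ‖S (max q.1 0) (q.2 - x) + (S (max q.1 0) x - S (max t 0) x)‖ := by
          rw [map_sub]; congr 1; abel
      _ ≤ _ := (norm_add_le _ _).trans (add_le_add
          (hS.contraction _ (le_max_right _ _) _)
          (hS.norm_sub_le (le_max_right _ _) (le_max_right _ _) _))
  refine squeeze_zero (fun _ => norm_nonneg _) hb ?_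
  have h1 : Tendsto (fun q : ℝ × X => ‖q.2 - x‖) (𝓝 (t, x)) (𝓝 0) := by
    have : Continuous fun q : ℝ × X => ‖q.2 - x‖ := by fun_prop
    simpa using this.tendsto (t, x)
  have h2 : Tendsto (fun q : ℝ × X => max q.1 0 - max t 0) (𝓝 (t, x)) (𝓝 0) := by
    have : Continuous fun q : ℝ × X => max q.1 0 - max t 0 := by fun_prop
    simpa using this.tendsto (t, x)
  have h3 := tendsto_iff_norm_sub_tendsto_zero.1 ((hS.tendsto_abs x).comp h2)
  simpa using h1.add h3

theorem continuous_apply (hS : IsContractionSemigroup S) {α : Type*} [TopologicalSpace α]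
    {f : α → ℝ} {g : α → X} (hf : Continuous f) (hg : Continuous g) :
    Continuous fun a => S (max (f a) 0) (g a) :=
  hS.continuous_uncurry.comp (hf.prodMk hg)

end IsContractionSemigroup

/-! ### Duhamel integrals and semilinear mild solutions -/

/-- The convolution `∫₀ᵗ S(t - s) g(s) ds`. -/
noncomputable def duhamel (S : ℝ → X →L[ℝ] X) (g : ℝ → X) (t : ℝ) : X :=
  -- The truncation is inactive for `0 ≤ s ≤ t`; it makes the integrand continuous on all of `ℝ`, as
  -- nothing is known of `S` at negative times.
  ∫ s in (0 : ℝ)..t, S (max (t - s) 0) (g s)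

section Duhamel

variable {S : ℝ → X →L[ℝ] X} {g k : ℝ → X}

theorem continuous_duhamel (hS : IsContractionSemigroup S) (hg : Continuous g) :
    Continuous (duhamel S g) := by
  have h : duhamel S g = fun t => ∫ s in (0 : ℝ)..t, S (max s 0) (g (t - s)) := by
    funext t
    have := intervalIntegral.integral_comp_sub_left
      (fun s => S (max s 0) (g (t - s))) t (a := 0) (b := t)
    simpa [duhamel] using this
  rw [h]
  refine intervalIntegral.continuous_parametric_intervalIntegral_of_continuous ?_ continuous_id
  exact hS.continuous_apply continuous_snd (by fun_prop)

theorem duhamel_sub (hS : IsContractionSemigroup S) (hg : Continuous g) (hk : Continuous k)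
    (t : ℝ) : duhamel S g t - duhamel S k t = duhamel S (fun s => g s - k s) t := by
  unfold duhamel
  rw [← intervalIntegral.integral_sub]
  · simp
  · exact (hS.continuous_apply (by fun_prop) hg).intervalIntegrable _ _
  · exact (hS.continuous_apply (by fun_prop) hk).intervalIntegrable _ _

theorem norm_duhamel_le (hS : IsContractionSemigroup S) (φ : ℝ → ℝ) (hφ : Continuous φ) {t : ℝ}
    (ht : 0 ≤ t) (h : ∀ s ∈ Icc 0 t, ‖g s‖ ≤ φ s) :
    ‖duhamel S g t‖ ≤ ∫ s in (0 : ℝ)..t, φ s := by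
  refine intervalIntegral.norm_integral_le_of_norm_le ht
    (Eventually.of_forall fun s hs => ?_) (hφ.intervalIntegrable _ _)
  exact (hS.contraction _ (le_max_right _ _) _).trans (h s ⟨hs.1.le, hs.2⟩)

theorem norm_duhamel_le_exp (hS : IsContractionSemigroup S) {M ω t : ℝ}
    (hM : 0 ≤ M) (hω : 0 < ω) (ht : 0 ≤ t) (h : ∀ s ∈ Icc 0 t, ‖g s‖ ≤ M * Real.exp (ω * s)) :
    ‖duhamel S g t‖ ≤ M / ω * Real.exp (ω * t) := by
  refine (norm_duhamel_le hS (fun s => M * Real.exp (ω * s)) (by fun_prop) ht h).trans ?_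
  rw [intervalIntegral.integral_const_mul, intervalIntegral.integral_comp_mul_left _ hω.ne',
    integral_exp]
  have h1 : M * (ω⁻¹ • (Real.exp (ω * t) - Real.exp (ω * 0))) =
      M / ω * (Real.exp (ω * t) - 1) := by
    simp [div_eq_mul_inv]; ring
  rw [h1]
  exact mul_le_mul_of_nonneg_left (by linarith) (by positivity)

end Duhamel

/-- `z` is a mild solution of `z' = A z + F z`, `z 0 = z₀`, where `S` is generated by `A`. -/
structure IsSemilinearSolution (S : ℝ → X →L[ℝ] X) (F : X → X) (z₀ : X) (z : ℝ → X) : Prop where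
  continuousOn : ContinuousOn z (Ici 0)
  formula : ∀ t : ℝ, 0 ≤ t → z t = S t z₀ + duhamel S (fun s => F (z (max s 0))) t

theorem _root_.ContinuousOn.comp_max_zero {Y : Type*} [TopologicalSpace Y] {z : ℝ → Y}
    (hz : ContinuousOn z (Ici 0)) : Continuous fun t => z (max t 0) :=
  hz.comp_continuous (by fun_prop) fun t => le_max_right t 0

namespace IsSemilinearSolution

variable {S : ℝ → X →L[ℝ] X} {F : X → X} {z₀ : X} {z : ℝ → X}

theorem continuous_max (hz : IsSemilinearSolution S F z₀ z) : Continuous fun t => z (max t 0) :=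
  hz.continuousOn.comp_max_zero

theorem apply_zero (hS : IsContractionSemigroup S) (hz : IsSemilinearSolution S F z₀ z) :
    z 0 = z₀ := by
  simpa [duhamel, hS.zero_apply] using hz.formula 0 le_rfl

/-- The equation is autonomous: splitting the integral at `t₀` and factoring `S t` out of the first
piece rebuilds `S t (z t₀)`. This lets local estimates at time `0` be used at every time. -/
theorem comp_add [CompleteSpace X] (hS : IsContractionSemigroup S) (hF : Continuous F)
    (hz : IsSemilinearSolution S F z₀ z) {t₀ : ℝ} (ht₀ : 0 ≤ t₀) :
    IsSemilinearSolution S F (z t₀) fun t => z (t₀ + t) := by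
  refine ⟨hz.continuousOn.comp (by fun_prop) fun t ht => add_nonneg ht₀ ht, fun t ht => ?_⟩
  have hg : Continuous fun s => F (z (max s 0)) := hF.comp hz.continuous_max
  have hint : ∀ a b r : ℝ, IntervalIntegrable
      (fun s => S (max (r - s) 0) (F (z (max s 0)))) MeasureTheory.volume a b := fun a b r =>
    (hS.continuous_apply (by fun_prop) hg).intervalIntegrable _ _
  have h1 : ∫ s in (0 : ℝ)..t₀, S (max (t₀ + t - s) 0) (F (z (max s 0))) =
      S t (duhamel S (fun s => F (z (max s 0))) t₀) := by
    rw [duhamel, ← ContinuousLinearMap.intervalIntegral_comp_comm _ (hint _ _ _)]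
    refine intervalIntegral.integral_congr fun s hs => ?_
    rw [uIcc_of_le ht₀] at hs
    have h2 : 0 ≤ t₀ - s := by linarith [hs.2]
    rw [max_eq_left h2, ← hS.add_apply ht h2, max_eq_left (by linarith)]
    congr 2; ring
  have h2 : ∫ s in t₀..(t₀ + t), S (max (t₀ + t - s) 0) (F (z (max s 0))) =
      duhamel S (fun s => F (z (t₀ + max s 0))) t := by
    have := intervalIntegral.integral_comp_add_left
      (fun s => S (max (t₀ + t - s) 0) (F (z (max s 0)))) t₀ (a := 0) (b := t)
    rw [add_zero] at this
    rw [← this, duhamel]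
    refine intervalIntegral.integral_congr fun s hs => ?_
    rw [uIcc_of_le ht] at hs
    rw [max_eq_left hs.1, max_eq_left (add_nonneg ht₀ hs.1), add_sub_add_left_eq_sub]
  rw [hz.formula (t₀ + t) (add_nonneg ht₀ ht), duhamel,
    ← intervalIntegral.integral_add_adjacent_intervals (hint 0 t₀ _) (hint t₀ _ _), h1, h2,
    hz.formula t₀ ht₀, map_add, ← hS.add_apply ht ht₀, add_comm t t₀, add_assoc]

theorem norm_sub_le (hS : IsContractionSemigroup S)
    (hz : IsSemilinearSolution S F z₀ z) (φ : ℝ → ℝ) (hφ : Continuous φ) {t : ℝ} (ht : 0 ≤ t)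
    (h : ∀ s ∈ Icc 0 t, ‖F (z s)‖ ≤ φ s) : ‖z t - S t z₀‖ ≤ ∫ s in (0 : ℝ)..t, φ s := by
  rw [hz.formula t ht, add_sub_cancel_left]
  refine norm_duhamel_le hS φ hφ ht fun s hs => ?_
  rw [max_eq_left hs.1]
  exact h s hs

theorem unique (hS : IsContractionSemigroup S) {L : ℝ≥0} (hF : LipschitzWith L F) {w : ℝ → X}
    (hz : IsSemilinearSolution S F z₀ z) (hw : IsSemilinearSolution S F z₀ w) :
    EqOn z w (Ici 0) := by
  have hc : Continuous fun s => ‖z (max s 0) - w (max s 0)‖ :=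
    (hz.continuous_max.sub hw.continuous_max).norm
  have hle : ∀ t, 0 ≤ t → ‖z t - w t‖ ≤
      L * ∫ s in (0 : ℝ)..t, ‖z (max s 0) - w (max s 0)‖ := fun t ht => by
    rw [hz.formula t ht, hw.formula t ht, add_sub_add_left_eq_sub,
      duhamel_sub hS (g := fun s => F (z (max s 0))) (k := fun s => F (w (max s 0)))
        (hF.continuous.comp hz.continuous_max) (hF.continuous.comp hw.continuous_max),
      ← intervalIntegral.integral_const_mul]
    exact norm_duhamel_le hS _ (hc.const_mul _) ht fun s _ => hF.norm_sub_le _ _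
  have hd : ∀ t, HasDerivAt (fun t => ∫ s in (0 : ℝ)..t, ‖z (max s 0) - w (max s 0)‖)
      ‖z (max t 0) - w (max t 0)‖ t := fun t =>
    intervalIntegral.integral_hasDerivAt_right (hc.intervalIntegrable _ _)
      (hc.stronglyMeasurableAtFilter _ _) hc.continuousAt
  intro t ht
  have ht : (0 : ℝ) ≤ t := ht
  -- Grönwall is applied to the primitive of `‖z - w‖`, because the difference itself satisfies only
  -- an integral inequality.
  have hI := norm_le_gronwallBound_of_norm_deriv_right_le (δ := 0) (K := L) (ε := 0) (a := 0)
    (b := t) (fun x _ => (hd x).continuousAt.continuousWithinAt)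
    (fun x _ => (hd x).hasDerivWithinAt) (by simp)
    (fun x hx => by
      have := hle x hx.1
      rw [max_eq_left hx.1, norm_norm, add_zero]
      exact this.trans (mul_le_mul_of_nonneg_left (le_abs_self _) L.2)) t ⟨ht, le_rfl⟩
  rw [gronwallBound_ε0_δ0, norm_le_zero_iff] at hI
  have := hle t ht
  rw [hI, mul_zero, norm_le_zero_iff, sub_eq_zero] at this
  exact this

end IsSemilinearSolution

open BoundedContinuousFunction in
-- Banach's fixed point theorem in an exponentially weighted norm: the unknown is `w = e^{-ωt} z`,
-- bounded on `ℝ`. The weight turns the Duhamel term into a map of Lipschitz constant `L/ω`, so a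
-- single contraction gives a global solution.
theorem exists_isSemilinearSolution [CompleteSpace X] {S : ℝ → X →L[ℝ] X} {F : X → X}
    (hS : IsContractionSemigroup S) {L : ℝ≥0} (hF : LipschitzWith L F) (hF0 : F 0 = 0) (z₀ : X) :
    ∃ z, IsSemilinearSolution S F z₀ z := by
  -- The factor `2` gives `L/ω ≤ 1/2`; the `+ 1` keeps `ω` positive when `L = 0`.
  set ω : ℝ := 2 * L + 1 with hω_def
  have hω : 0 < ω := by positivity
  have hLω : L / ω ≤ 1 / 2 := by rw [div_le_iff₀ hω]; linarith
  let G : (ℝ →ᵇ X) → ℝ → X := fun w s => F (Real.exp (ω * max s 0) • w (max s 0))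
  have hG : ∀ w, Continuous (G w) := fun w => hF.continuous.comp <|
    Continuous.smul (by fun_prop) (w.continuous.comp (by fun_prop))
  let Ψ : (ℝ →ᵇ X) → ℝ → X := fun w t =>
    Real.exp (-(ω * max t 0)) • (S (max t 0) z₀ + duhamel S (G w) (max t 0))
  have hΨ : ∀ w, Continuous (Ψ w) := fun w => Continuous.smul (by fun_prop)
    ((hS.continuous_apply continuous_id continuous_const).add
      ((continuous_duhamel hS (hG w)).comp (by fun_prop)))
  have hGd : ∀ (w v : ℝ →ᵇ X) (s : ℝ), 0 ≤ s →
      ‖G w s - G v s‖ ≤ L * ‖w - v‖ * Real.exp (ω * s) := fun w v s hs => by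
    refine (hF.norm_sub_le _ _).trans ?_
    rw [← smul_sub, norm_smul, Real.norm_of_nonneg (Real.exp_pos _).le, max_eq_left hs, mul_assoc,
      mul_comm (Real.exp _)]
    gcongr
    exact (w - v).norm_coe_le_norm s
  have hdiff : ∀ (w v : ℝ →ᵇ X) (t : ℝ), ‖Ψ w t - Ψ v t‖ ≤ 1 / 2 * ‖w - v‖ := fun w v t => by
    have h0 : 0 ≤ max t 0 := le_max_right _ _
    simp only [Ψ]
    rw [← smul_sub, add_sub_add_left_eq_sub, duhamel_sub hS (hG w) (hG v), norm_smul,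
      Real.norm_of_nonneg (Real.exp_pos _).le]
    calc _ ≤ Real.exp (-(ω * max t 0)) * (L * ‖w - v‖ / ω * Real.exp (ω * max t 0)) := by
          gcongr
          exact norm_duhamel_le_exp hS (by positivity) hω h0 fun s hs => hGd w v s hs.1
      _ = L / ω * ‖w - v‖ := by
          rw [Real.exp_neg]; field_simp
      _ ≤ _ := by gcongr
  have hG0 : Ψ 0 = fun t => Real.exp (-(ω * max t 0)) • S (max t 0) z₀ := by
    funext t; simp [Ψ, G, hF0, duhamel]
  have hbd : ∀ w t, ‖Ψ w t‖ ≤ ‖z₀‖ + 1 / 2 * ‖w‖ := fun w t => by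
    have h1 := hdiff w 0 t
    have h2 : ‖Ψ 0 t‖ ≤ ‖z₀‖ := by
      rw [hG0]
      simp only [norm_smul, Real.norm_of_nonneg (Real.exp_pos _).le]
      have h3 : Real.exp (-(ω * max t 0)) ≤ 1 := by
        rw [Real.exp_le_one_iff]
        have : 0 ≤ ω * max t 0 := mul_nonneg hω.le (le_max_right _ _)
        linarith
      calc _ ≤ 1 * ‖z₀‖ := by
            gcongr
            exact hS.contraction _ (le_max_right _ _) _
        _ = _ := one_mul _
    rw [sub_zero] at h1
    have := norm_sub_norm_le (Ψ w t) (Ψ 0 t)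
    linarith
  let Φ : (ℝ →ᵇ X) → (ℝ →ᵇ X) := fun w =>
    BoundedContinuousFunction.ofNormedAddCommGroup (Ψ w) (hΨ w) _ (hbd w)
  have hΦ : ContractingWith (1 / 2) Φ := by
    refine ⟨by rw [← NNReal.coe_lt_coe]; norm_num, LipschitzWith.of_dist_le_mul fun w v => ?_⟩
    rw [dist_eq_norm, dist_eq_norm]
    refine (BoundedContinuousFunction.norm_le (by positivity)).2 fun t => ?_
    simpa [Φ] using hdiff w v t
  obtain ⟨w, hw⟩ : ∃ w, Φ w = w := ⟨_, hΦ.fixedPoint_isFixedPt⟩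
  refine ⟨fun t => Real.exp (ω * t) • w t,
    (Continuous.smul (by fun_prop) w.continuous).continuousOn, fun t ht => ?_⟩
  have h1 : w t = Ψ w t := by
    conv_lhs => rw [← hw]
    rfl
  rw [h1]
  simp only [Ψ, max_eq_left ht]
  rw [smul_smul, ← Real.exp_add, add_neg_cancel, Real.exp_zero, one_smul]

/-! ### The pairing and the feedback field: bounds and Lipschitz continuity -/

theorem norm_eq_of_mem_dualityMap {y : X} {φ : StrongDual ℝ X} (hφ : φ ∈ dualityMap y) :
    ‖φ‖ = ‖y‖ :=
  (sq_eq_sq₀ (norm_nonneg _) (norm_nonneg _)).1 hφ.2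

theorem abs_pairing_le (B : X →L[ℝ] X) (y : X) : |pairing B y| ≤ ‖B‖ * ‖y‖ ^ 2 := by
  have h := (dualityMap_nonempty y).choose_spec
  calc _ ≤ ‖(dualityMap_nonempty y).choose‖ * ‖B y‖ := ContinuousLinearMap.le_opNorm _ _
    _ ≤ ‖y‖ * (‖B‖ * ‖y‖) := by
        rw [norm_eq_of_mem_dualityMap h]
        gcongr
        exact B.le_opNorm y
    _ = _ := by ring

/-- The continuous extension by zero of `|⟨B y, J y⟩| / ‖y‖`. -/
noncomputable def normalizedPairing (B : X →L[ℝ] X) (y : X) : ℝ := |pairing B y| / ‖y‖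

theorem normalizedPairing_nonneg (B : X →L[ℝ] X) (y : X) : 0 ≤ normalizedPairing B y :=
  div_nonneg (abs_nonneg _) (norm_nonneg _)

theorem normalizedPairing_le (B : X →L[ℝ] X) (y : X) : normalizedPairing B y ≤ ‖B‖ * ‖y‖ :=
  div_le_of_le_mul₀ (norm_nonneg _) (by positivity)
    ((abs_pairing_le B y).trans_eq (by ring))

theorem abs_pairing_eq (B : X →L[ℝ] X) (y : X) :
    |pairing B y| = normalizedPairing B y * ‖y‖ := by
  rcases eq_or_ne y 0 with rfl | hy
  · simpa using abs_pairing_le B 0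
  · rw [normalizedPairing, div_mul_cancel₀ _ (norm_ne_zero_iff.2 hy)]

/-- Division by zero gives `0`, so the quotient formula also covers `y = 0`. -/
theorem feedback_eq (B : X →L[ℝ] X) (lam : ℝ) (y : X) :
    feedback B lam y = -lam * (pairing B y / ‖y‖ ^ 2) := by
  unfold feedback
  split_ifs with h
  · simp [h]
  · rw [mul_div_assoc]

theorem feedback_mul_pairing (B : X →L[ℝ] X) (lam : ℝ) (y : X) :
    feedback B lam y * pairing B y = -lam * normalizedPairing B y ^ 2 := by
  rw [feedback_eq, normalizedPairing, div_pow, sq_abs]; ring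

theorem abs_pairing_div_le (B : X →L[ℝ] X) (y : X) : |pairing B y / ‖y‖ ^ 2| ≤ ‖B‖ := by
  rw [abs_div, abs_of_nonneg (sq_nonneg ‖y‖)]
  exact div_le_of_le_mul₀ (by positivity) (norm_nonneg _) (abs_pairing_le B y)

/-- The vector field `z ↦ u B z` with `u` the feedback control. -/
noncomputable def feedbackField (B : X →L[ℝ] X) (lam : ℝ) (y : X) : X := feedback B lam y • B y

theorem feedbackField_zero (B : X →L[ℝ] X) (lam : ℝ) : feedbackField B lam 0 = 0 := by
  simp [feedbackField]

theorem norm_feedbackField_le (B : X →L[ℝ] X) {lam : ℝ} (hl : 0 ≤ lam) (y : X) :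
    ‖feedbackField B lam y‖ ≤ lam * ‖B‖ * normalizedPairing B y := by
  rcases eq_or_ne y 0 with rfl | hy
  · simp [feedbackField, normalizedPairing]
  have hy : 0 < ‖y‖ := norm_pos_iff.2 hy
  rw [feedbackField, norm_smul, feedback_eq, Real.norm_eq_abs, abs_mul, abs_neg, abs_of_nonneg hl,
    abs_div, abs_of_nonneg (sq_nonneg ‖y‖), normalizedPairing]
  calc _ ≤ lam * (|pairing B y| / ‖y‖ ^ 2) * (‖B‖ * ‖y‖) := by
        gcongr
        exact B.le_opNorm y
    _ = _ := by field_simp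

namespace PairingLipschitz

variable {B : X →L[ℝ] X} {𝒦 : ℝ≥0 → ℝ≥0 → ℝ≥0} {C : ℝ}

theorem abs_sub_le (hB : PairingLipschitz B 𝒦 C) {y z : X} {r : ℝ} (hy : ‖y‖ ≤ r)
    (hz : ‖z‖ ≤ r) : |pairing B y - pairing B z| ≤ C * r * ‖y - z‖ := by
  lift r to ℝ≥0 using (norm_nonneg y).trans hy
  refine (hB.lipschitz y z).trans (mul_le_mul_of_nonneg_right ?_ (norm_nonneg _))
  exact (NNReal.coe_le_coe.2 (hB.mono _ _ r r hy hz)).trans (hB.diag_le r)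

theorem continuous_pairing (hB : PairingLipschitz B 𝒦 C) : Continuous (pairing B) := by
  rw [continuous_iff_continuousAt]
  intro x
  rw [ContinuousAt, tendsto_iff_norm_sub_tendsto_zero]
  refine squeeze_zero (fun _ => norm_nonneg _)
    (fun y => hB.abs_sub_le (le_max_left ‖y‖ ‖x‖) (le_max_right _ _)) ?_
  have : Continuous fun y => C * max ‖y‖ ‖x‖ * ‖y - x‖ := by fun_prop
  simpa using this.tendsto x

theorem continuous_normalizedPairing (hB : PairingLipschitz B 𝒦 C) :
    Continuous (normalizedPairing B) := by
  rw [continuous_iff_continuousAt]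
  intro x
  rcases eq_or_ne x 0 with rfl | hx
  · have h0 : normalizedPairing B 0 = 0 := by simp [normalizedPairing]
    rw [ContinuousAt, h0]
    refine squeeze_zero (normalizedPairing_nonneg B) (normalizedPairing_le B) ?_
    have : Continuous fun y : X => ‖B‖ * ‖y‖ := by fun_prop
    simpa using this.tendsto 0
  · exact hB.continuous_pairing.abs.continuousAt.div continuous_norm.continuousAt
      (norm_ne_zero_iff.2 hx)

/-- Replacing the weight `‖y‖` by the larger `‖z‖` and clearing one more `‖z‖` leaves `r (‖z‖² -
‖y‖²)` plus a difference of pairings, where `r = ⟨By, J y⟩ / ‖y‖²` is bounded by `‖B‖`. The weight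
compensates for the possible discontinuity of the feedback at `0`. -/
theorem abs_sub_div_mul_le (hB : PairingLipschitz B 𝒦 C) {y z : X} (h : ‖y‖ ≤ ‖z‖) :
    |pairing B y / ‖y‖ ^ 2 - pairing B z / ‖z‖ ^ 2| * ‖y‖ ≤ (2 * ‖B‖ + C) * ‖y - z‖ := by
  have hC := hB.pos.le
  rcases eq_or_ne y 0 with rfl | hy
  · rw [norm_zero, mul_zero]; positivity
  have hy : 0 < ‖y‖ := norm_pos_iff.2 hy
  have hz : 0 < ‖z‖ := hy.trans_le h
  refine (mul_le_mul_of_nonneg_left h (abs_nonneg _)).trans (le_of_mul_le_mul_right ?_ hz)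
  set r := pairing B y / ‖y‖ ^ 2
  have h1 : (r - pairing B z / ‖z‖ ^ 2) * (‖z‖ * ‖z‖) =
      r * ((‖z‖ - ‖y‖) * (‖z‖ + ‖y‖)) + (pairing B y - pairing B z) := by
    simp only [r]; field_simp; ring
  have h2 : ‖z‖ - ‖y‖ ≤ ‖y - z‖ := by
    rw [norm_sub_rev]; exact norm_sub_norm_le z y
  calc _ = |(r - pairing B z / ‖z‖ ^ 2) * (‖z‖ * ‖z‖)| := by
        rw [abs_mul, abs_of_nonneg (mul_self_nonneg ‖z‖), mul_assoc]
    _ ≤ |r| * ((‖z‖ - ‖y‖) * (‖z‖ + ‖y‖)) + |pairing B y - pairing B z| := by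
        rw [h1]
        refine (abs_add_le _ _).trans_eq ?_
        rw [abs_mul, abs_of_nonneg (a := (‖z‖ - ‖y‖) * (‖z‖ + ‖y‖))
          (mul_nonneg (sub_nonneg.2 h) (by positivity))]
    _ ≤ ‖B‖ * (‖y - z‖ * (‖z‖ + ‖z‖)) + C * ‖z‖ * ‖y - z‖ := by
        gcongr
        · exact abs_pairing_div_le B y
        · exact hB.abs_sub_le h le_rfl
    _ = _ := by ring

theorem exists_lipschitzWith (hB : PairingLipschitz B 𝒦 C) {lam : ℝ} (hl : 0 ≤ lam) :
    ∃ L : ℝ≥0, LipschitzWith L (feedbackField B lam) := by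
  have hC := hB.pos.le
  refine ⟨NNReal.mk (lam * ((2 * ‖B‖ + C) * ‖B‖ + ‖B‖ * ‖B‖)) (by positivity),
    LipschitzWith.of_dist_le_mul fun y z => ?_⟩
  rw [dist_eq_norm, dist_eq_norm, NNReal.coe_mk]
  wlog h : ‖y‖ ≤ ‖z‖ generalizing y z
  · rw [norm_sub_rev, norm_sub_rev y]
    exact this z y (le_of_not_ge h)
  set r := pairing B y / ‖y‖ ^ 2
  set q := pairing B z / ‖z‖ ^ 2
  -- The difference of gains multiplies `B y`, the vector of smaller norm, as the weighted estimate
  -- requires.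
  have h1 : feedbackField B lam y - feedbackField B lam z =
      (-lam) • ((r - q) • B y + q • B (y - z)) := by
    simp only [feedbackField, feedback_eq, map_sub]
    module
  rw [h1, norm_smul, norm_neg, Real.norm_of_nonneg hl, mul_assoc]
  refine mul_le_mul_of_nonneg_left ((norm_add_le _ _).trans ?_) hl
  rw [norm_smul, norm_smul, Real.norm_eq_abs, Real.norm_eq_abs]
  calc _ ≤ |r - q| * (‖B‖ * ‖y‖) + ‖B‖ * (‖B‖ * ‖y - z‖) := by
        gcongr
        · exact B.le_opNorm y
        · exact abs_pairing_div_le B z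
        · exact B.le_opNorm _
    _ = |r - q| * ‖y‖ * ‖B‖ + ‖B‖ * ‖B‖ * ‖y - z‖ := by ring
    _ ≤ (2 * ‖B‖ + C) * ‖y - z‖ * ‖B‖ + ‖B‖ * ‖B‖ * ‖y - z‖ :=
        add_le_add_left (mul_le_mul_of_nonneg_right (hB.abs_sub_div_mul_le h) (norm_nonneg _)) _
    _ = _ := by ring

/-- An implicit convexity inequality: testing with `φ ∈ J(y)` at the endpoint `y = x + h u B x`
bounds `‖y‖²` without differentiating the norm. Rewriting `B x = B y - h B(u B x)` then produces the
pairing at `y` with an `O(h²)` error. -/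
theorem norm_sq_add_smul_le (hB : PairingSingleValued B) (x : X) (u : ℝ) {h : ℝ} (hh : 0 ≤ h) :
    ‖x + h • u • B x‖ ^ 2 ≤ ‖x‖ ^ 2 + 2 * h * (u * pairing B (x + h • u • B x) +
      h * (|u| * (‖x + h • u • B x‖ * ‖B (u • B x)‖))) := by
  set y := x + h • u • B x with hy
  obtain ⟨φ, hφ⟩ := dualityMap_nonempty y
  have h1 : φ x ≤ ‖y‖ * ‖x‖ := by
    have := (le_abs_self _).trans (φ.le_opNorm x)
    rwa [norm_eq_of_mem_dualityMap hφ] at this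
  have h2 : |φ (B (u • B x))| ≤ ‖y‖ * ‖B (u • B x)‖ := by
    have := φ.le_opNorm (B (u • B x))
    rwa [norm_eq_of_mem_dualityMap hφ] at this
  have h3 : ‖y‖ ^ 2 = φ x + h * (u * φ (B x)) := by
    rw [← hφ.1, hy]; simp
  have h4 : φ (B x) = pairing B y - h * φ (B (u • B x)) := by
    rw [pairing_eq hB hφ]
    rw [show B y = B x + h • B (u • B x) by rw [hy, map_add, map_smul]]
    simp
  have h5 : -(u * φ (B (u • B x))) ≤ |u| * (‖y‖ * ‖B (u • B x)‖) := by
    refine (neg_le_abs _).trans ?_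
    rw [abs_mul]
    gcongr
  have h6 := mul_le_mul_of_nonneg_left h5 (mul_nonneg hh hh)
  rw [h4] at h3
  -- Young's inequality `2 ‖y‖ ‖x‖ ≤ ‖y‖² + ‖x‖²` absorbs half of `‖y‖²`.
  nlinarith [sq_nonneg (‖y‖ - ‖x‖)]

end PairingLipschitz

/-! ### Energy dissipation along solutions -/

variable {S : ℝ → X →L[ℝ] X} {z₀ : X} {z : ℝ → X}

namespace IsSemilinearSolution

/-- Replacing `F(z(s))` by `S(s) F(z₀)` in the Duhamel integral makes `S(h)` a common factor,
removable by contractivity. The error is `h` times the mean of a continuous function vanishing at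
`0`. No membership of `z₀` in the domain of the generator is needed. -/
theorem exists_norm_le_euler [CompleteSpace X] {F : X → X} (hS : IsContractionSemigroup S)
    (hF : Continuous F) (hz : IsSemilinearSolution S F z₀ z) :
    ∃ ρ : ℝ → ℝ, Tendsto ρ (𝓝[>] 0) (𝓝 0) ∧
      ∀ h, 0 < h → ‖z h‖ ≤ ‖z₀ + h • F z₀‖ + h * ρ h := by
  set k : ℝ → ℝ := fun s => ‖F (z (max s 0)) - S (max s 0) (F z₀)‖
  have hFz : Continuous fun s => F (z (max s 0)) := hF.comp hz.continuous_max
  have hSv : Continuous fun s => S (max s 0) (F z₀) :=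
    hS.continuous_apply continuous_id continuous_const
  have hk : Continuous k := (hFz.sub hSv).norm
  have hk0 : k 0 = 0 := by simp [k, hz.apply_zero hS, hS.zero_apply]
  refine ⟨fun h => h⁻¹ * ∫ s in (0 : ℝ)..h, k s, ?_, fun h hh => ?_⟩
  · have hd : HasDerivAt (fun t => ∫ s in (0 : ℝ)..t, k s) (k 0) 0 :=
      intervalIntegral.integral_hasDerivAt_right (hk.intervalIntegrable _ _)
        (hk.stronglyMeasurableAtFilter _ _) hk.continuousAt
    have := hd.tendsto_slope_zero_right
    simpa [hk0] using this
  · have h1 : duhamel S (fun s => S (max s 0) (F z₀)) h = S h (h • F z₀) := by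
      have : duhamel S (fun s => S (max s 0) (F z₀)) h = ∫ _ in (0 : ℝ)..h, S h (F z₀) := by
        refine intervalIntegral.integral_congr fun s hs => ?_
        rw [uIcc_of_le hh.le] at hs
        have h2 : 0 ≤ h - s := by linarith [hs.2]
        beta_reduce
        rw [max_eq_left h2, max_eq_left hs.1, ← hS.add_apply h2 hs.1, sub_add_cancel]
      rw [this]; simp
    have h2 : z h = S h (z₀ + h • F z₀) +
        duhamel S (fun s => F (z (max s 0)) - S (max s 0) (F z₀)) h := by
      rw [← duhamel_sub hS hFz hSv, h1, hz.formula h hh.le, map_add]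
      abel
    rw [h2, mul_inv_cancel_left₀ hh.ne']
    exact (norm_add_le _ _).trans (add_le_add (hS.contraction h hh.le _)
      (norm_duhamel_le hS k hk hh.le fun s _ => le_rfl))

variable {B : X →L[ℝ] X} {𝒦 : ℝ≥0 → ℝ≥0 → ℝ≥0} {C lam : ℝ}

theorem eventually_norm_sq_slope_lt [CompleteSpace X] (hS : IsContractionSemigroup S)
    (hB : PairingLipschitz B 𝒦 C) (hl : 0 ≤ lam)
    (hz : IsSemilinearSolution S (feedbackField B lam) z₀ z) {r : ℝ}
    (hr : -(2 * lam) * normalizedPairing B z₀ ^ 2 < r) :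
    ∀ᶠ h in 𝓝[>] (0 : ℝ), h⁻¹ * (‖z h‖ ^ 2 - ‖z₀‖ ^ 2) < r := by
  obtain ⟨L, hL⟩ := hB.exists_lipschitzWith hl
  obtain ⟨ρ, hρ, hzρ⟩ := hz.exists_norm_le_euler hS hL.continuous
  set u := feedback B lam z₀
  let y : ℝ → X := fun h => z₀ + h • u • B z₀
  have hid : Tendsto (fun h : ℝ => h) (𝓝[>] 0) (𝓝 0) := nhdsWithin_le_nhds
  have hy : Continuous y := by fun_prop
  have hy0 : y 0 = z₀ := by simp [y]
  have hyl : Tendsto y (𝓝[>] 0) (𝓝 z₀) := by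
    simpa [hy0] using (hy.tendsto 0).mono_left nhdsWithin_le_nhds
  have hp : Tendsto (fun h => pairing B (y h)) (𝓝[>] 0) (𝓝 (pairing B z₀)) :=
    (hB.continuous_pairing.tendsto z₀).comp hyl
  have hlim : Tendsto (fun h => 2 * (u * pairing B (y h) +
      h * (|u| * (‖y h‖ * ‖B (u • B z₀)‖))) + 2 * ρ h * ‖y h‖ + h * ρ h ^ 2) (𝓝[>] 0)
      (𝓝 (2 * (u * pairing B z₀ + 0 * (|u| * (‖z₀‖ * ‖B (u • B z₀)‖))) + 2 * 0 * ‖z₀‖ +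
        0 * 0 ^ 2)) :=
    ((((hp.const_mul u).add (hid.mul ((hyl.norm.mul_const _).const_mul _))).const_mul 2).add
      ((hρ.const_mul 2).mul hyl.norm)).add (hid.mul (hρ.pow 2))
  have hr' : 2 * (u * pairing B z₀ + 0 * (|u| * (‖z₀‖ * ‖B (u • B z₀)‖))) + 2 * 0 * ‖z₀‖ +
        0 * 0 ^ 2 < r := by
    refine lt_of_eq_of_lt ?_ hr
    simp only [u, feedback_mul_pairing]; ring
  filter_upwards [hlim.eventually_lt_const hr', self_mem_nhdsWithin] with h hlt hh
  have hh : 0 < h := hh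
  refine lt_of_le_of_lt ?_ hlt
  rw [inv_mul_le_iff₀ hh]
  have h1 := PairingLipschitz.norm_sq_add_smul_le hB.singleValued z₀ u hh.le
  have h2 : ‖z h‖ ^ 2 ≤ (‖y h‖ + h * ρ h) ^ 2 := pow_le_pow_left₀ (norm_nonneg _) (hzρ h hh) 2
  simp only [y] at h2 ⊢
  linarith

/-- The energy need not be differentiable, so the upper bound on its right Dini slopes is integrated
by a comparison theorem. -/
theorem norm_sq_le [CompleteSpace X] (hS : IsContractionSemigroup S)
    (hB : PairingLipschitz B 𝒦 C) (hl : 0 ≤ lam)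
    (hz : IsSemilinearSolution S (feedbackField B lam) z₀ z) {t : ℝ} (ht : 0 ≤ t) :
    ‖z t‖ ^ 2 ≤ ‖z₀‖ ^ 2 -
      2 * lam * ∫ s in (0 : ℝ)..t, normalizedPairing B (z (max s 0)) ^ 2 := by
  obtain ⟨L, hL⟩ := hB.exists_lipschitzWith hl
  set q : ℝ → ℝ := fun s => normalizedPairing B (z (max s 0)) ^ 2
  have hq : Continuous q := (hB.continuous_normalizedPairing.comp hz.continuous_max).pow 2
  have hd : ∀ x, HasDerivAt (fun t => ‖z₀‖ ^ 2 - 2 * lam * ∫ s in (0 : ℝ)..t, q s)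
      (-(2 * lam * q x)) x := fun x =>
    ((intervalIntegral.integral_hasDerivAt_right (hq.intervalIntegrable _ _)
      (hq.stronglyMeasurableAtFilter _ _) hq.continuousAt).const_mul _).const_sub _
  refine image_le_of_liminf_slope_right_le_deriv_boundary (f := fun t => ‖z t‖ ^ 2) (a := 0)
    (b := t) ((hz.continuousOn.norm.pow 2).mono fun s hs => hs.1) ?_
    (fun x _ => (hd x).continuousAt.continuousWithinAt)
    (fun x _ => (hd x).hasDerivWithinAt) (fun x hx r hr => ?_) ⟨ht, le_rfl⟩
  · simp [hz.apply_zero hS]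
  -- The slope bound at time `x` is the one at time `0` for the solution restarted from `z x`.
  · have h1 := (hz.comp_add hS hL.continuous hx.1).eventually_norm_sq_slope_lt hS hB hl (r := r)
      (by simpa [q, max_eq_left hx.1] using hr)
    have h2 : Tendsto (fun y => y - x) (𝓝[>] x) (𝓝[>] 0) := by
      refine tendsto_nhdsWithin_iff.2 ⟨?_, ?_⟩
      · have : Continuous fun y : ℝ => y - x := by fun_prop
        simpa using (this.tendsto x).mono_left nhdsWithin_le_nhds
      · filter_upwards [self_mem_nhdsWithin] with y hy using sub_pos.2 (mem_Ioi.1 hy)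
    refine Eventually.frequently ?_
    filter_upwards [h2.eventually h1] with y hy
    simpa [slope] using hy

theorem norm_le [CompleteSpace X] (hS : IsContractionSemigroup S)
    (hB : PairingLipschitz B 𝒦 C) (hl : 0 ≤ lam)
    (hz : IsSemilinearSolution S (feedbackField B lam) z₀ z) {t : ℝ} (ht : 0 ≤ t) :
    ‖z t‖ ≤ ‖z₀‖ := by
  have h1 := hz.norm_sq_le hS hB hl ht
  have h2 : 0 ≤ ∫ s in (0 : ℝ)..t, normalizedPairing B (z (max s 0)) ^ 2 :=
    intervalIntegral.integral_nonneg ht fun _ _ => sq_nonneg _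
  refine (sq_le_sq₀ (norm_nonneg _) (norm_nonneg _)).1 ?_
  have := mul_nonneg (mul_nonneg zero_le_two hl) h2
  linarith

end IsSemilinearSolution

/-! ### Observation along the closed loop, and exponential decay -/

/-- Cauchy-Schwarz, obtained by expanding `∫ (T f - I)² ≥ 0`. -/
theorem sq_intervalIntegral_le {f : ℝ → ℝ} (hf : Continuous f) {T : ℝ} (hT : 0 < T) :
    (∫ s in (0 : ℝ)..T, f s) ^ 2 ≤ T * ∫ s in (0 : ℝ)..T, f s ^ 2 := by
  set I := ∫ s in (0 : ℝ)..T, f s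
  have h1 : 0 ≤ ∫ s in (0 : ℝ)..T, (T * f s - I) ^ 2 :=
    intervalIntegral.integral_nonneg hT.le fun _ _ => sq_nonneg _
  have h2 : ∫ s in (0 : ℝ)..T, (T * f s - I) ^ 2 =
      T ^ 2 * (∫ s in (0 : ℝ)..T, f s ^ 2) - 2 * T * I * I + T * I ^ 2 := by
    have h3 : ∀ s, (T * f s - I) ^ 2 = T ^ 2 * f s ^ 2 - 2 * T * I * f s + I ^ 2 := fun s => by
      ring
    simp_rw [h3]
    rw [intervalIntegral.integral_add (Continuous.intervalIntegrable (by fun_prop) _ _)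
      (Continuous.intervalIntegrable (by fun_prop) _ _),
      intervalIntegral.integral_sub (Continuous.intervalIntegrable (by fun_prop) _ _)
      (Continuous.intervalIntegrable (by fun_prop) _ _), intervalIntegral.integral_const_mul,
      intervalIntegral.integral_const_mul]
    simp [I]
  rw [h2] at h1
  refine le_of_mul_le_mul_left ?_ hT
  linarith

section Decay

variable {S : ℝ → X →L[ℝ] X} {B : X →L[ℝ] X} {𝒦 : ℝ≥0 → ℝ≥0 → ℝ≥0} {C T δ lam : ℝ}

theorem IsSemilinearSolution.observation_le [CompleteSpace X] (hS : IsContractionSemigroup S)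
    (hB : PairingLipschitz B 𝒦 C) (hO : Observation S B T δ) (hl : 0 ≤ lam) (hlT : lam * T ≤ 1)
    {z₀ : X} {z : ℝ → X} (hz : IsSemilinearSolution S (feedbackField B lam) z₀ z) :
    δ * ‖S T z₀‖ ^ 2 ≤
      ‖z₀‖ * (1 + C * ‖B‖) * ∫ s in (0 : ℝ)..T, normalizedPairing B (z (max s 0)) := by
  have hC := hB.pos.le
  have hT := hO.pos_T.le
  set q : ℝ → ℝ := fun s => normalizedPairing B (z (max s 0))
  have hq : Continuous q := hB.continuous_normalizedPairing.comp hz.continuous_max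
  have hq0 : ∀ s, 0 ≤ q s := fun s => normalizedPairing_nonneg _ _
  set I := ∫ s in (0 : ℝ)..T, q s
  have hI : 0 ≤ I := intervalIntegral.integral_nonneg hT fun s _ => hq0 s
  have hdist : ∀ t ∈ Icc 0 T, ‖z t - S t z₀‖ ≤ lam * ‖B‖ * I := fun t ht => by
    refine (hz.norm_sub_le hS (fun s => lam * ‖B‖ * q s) (by fun_prop) ht.1 fun s hs => ?_).trans ?_
    · simpa only [q, max_eq_left hs.1] using norm_feedbackField_le B hl (z s)
    · rw [intervalIntegral.integral_const_mul]
      refine mul_le_mul_of_nonneg_left ?_ (by positivity)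
      exact intervalIntegral.integral_mono_interval le_rfl ht.1 ht.2
        (Eventually.of_forall hq0) (hq.intervalIntegrable _ _)
  have hpt : ∀ t ∈ Icc 0 T, |pairing B (S (max t 0) z₀)| ≤
      ‖z₀‖ * q t + C * ‖z₀‖ * (lam * ‖B‖ * I) := fun t ht => by
    have hzt := hz.norm_le hS hB hl ht.1
    simp only [q, max_eq_left ht.1]
    have h1 := hB.abs_sub_le (hS.contraction t ht.1 z₀) hzt
    have h2 : |pairing B (z t)| ≤ ‖z₀‖ * normalizedPairing B (z t) := by
      rw [abs_pairing_eq, mul_comm]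
      exact mul_le_mul_of_nonneg_right hzt (normalizedPairing_nonneg _ _)
    have h3 : C * ‖z₀‖ * ‖S t z₀ - z t‖ ≤ C * ‖z₀‖ * (lam * ‖B‖ * I) := by
      rw [norm_sub_rev]
      exact mul_le_mul_of_nonneg_left (hdist t ht) (by positivity)
    have h4 := abs_sub_abs_le_abs_sub (pairing B (S t z₀)) (pairing B (z t))
    linarith
  have hcongr : ∫ t in (0 : ℝ)..T, |pairing B (S t z₀)| =
      ∫ t in (0 : ℝ)..T, |pairing B (S (max t 0) z₀)| := by
    refine intervalIntegral.integral_congr fun s hs => ?_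
    rw [uIcc_of_le hT] at hs
    simp only [max_eq_left hs.1]
  have hint : ∫ t in (0 : ℝ)..T, |pairing B (S (max t 0) z₀)| ≤
      ∫ t in (0 : ℝ)..T, (‖z₀‖ * q t + C * ‖z₀‖ * (lam * ‖B‖ * I)) :=
    intervalIntegral.integral_mono_on hT
      ((hB.continuous_pairing.comp
        (hS.continuous_apply continuous_id continuous_const)).abs.intervalIntegrable _ _)
      (Continuous.intervalIntegrable (by fun_prop) _ _) hpt
  rw [intervalIntegral.integral_add (Continuous.intervalIntegrable (by fun_prop) _ _)
    (Continuous.intervalIntegrable (by fun_prop) _ _), intervalIntegral.integral_const_mul,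
    intervalIntegral.integral_const, sub_zero, smul_eq_mul] at hint
  refine ((hO.estimate z₀).trans (hcongr.le.trans hint)).trans ?_
  -- Integrating the constant over `[0, T]` leaves a factor `λT`, and `λT ≤ 1` yields the `λ`-free
  -- constant `1 + C‖B‖`.
  have h5 : C * ‖z₀‖ * ‖B‖ * I * (lam * T) ≤ C * ‖z₀‖ * ‖B‖ * I * 1 :=
    mul_le_mul_of_nonneg_left hlT (by positivity)
  linarith

theorem add_pow_four_le (a b : ℝ) : (a + b) ^ 4 ≤ 8 * (a ^ 4 + b ^ 4) := by
  have h1 : (a + b) ^ 2 ≤ 2 * (a ^ 2 + b ^ 2) := add_sq_le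
  have h2 := pow_le_pow_left₀ (sq_nonneg _) h1 2
  have h3 : (a ^ 2 + b ^ 2) ^ 2 ≤ 2 * ((a ^ 2) ^ 2 + (b ^ 2) ^ 2) := add_sq_le
  nlinarith

theorem le_gainConst (b T lam : ℝ) : lam * b ^ 2 * T ≤ gainConst b T lam := by
  have := Real.add_one_le_exp (lam * b ^ 2 * T)
  unfold gainConst; linarith

theorem obsConst_sq {b : ℝ} (hT : 0 ≤ T) : obsConst b C T ^ 2 = (1 + C * b) ^ 2 * T := by
  rw [obsConst, mul_pow, Real.sq_sqrt hT]

theorem IsSemilinearSolution.norm_pow_four_le [CompleteSpace X] (hS : IsContractionSemigroup S)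
    (hB : PairingLipschitz B 𝒦 C) (hO : Observation S B T δ) (hl : 0 < lam) (hlT : lam * T ≤ 1)
    (hlB : lam * ‖B‖ ^ 2 * T ≤ 1 / 2)
    {z₀ : X} {z : ℝ → X} (hz : IsSemilinearSolution S (feedbackField B lam) z₀ z) :
    ‖z T‖ ^ 4 ≤ decayRatio ‖B‖ C T δ lam * ‖z₀‖ ^ 4 := by
  have hC := hB.pos
  have hT := hO.pos_T
  have hδ := hO.pos_δ
  have hobs := hz.observation_le hS hB hO hl.le hlT
  have hen := hz.norm_sq_le hS hB hl.le hT.le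
  have hq : Continuous fun s => normalizedPairing B (z (max s 0)) :=
    hB.continuous_normalizedPairing.comp hz.continuous_max
  have hcs := sq_intervalIntegral_le hq hT
  have hdist : ‖z T - S T z₀‖ ≤ lam * ‖B‖ ^ 2 * T * ‖z₀‖ := by
    refine (hz.norm_sub_le hS (fun _ => lam * ‖B‖ ^ 2 * ‖z₀‖) continuous_const hT.le
      fun s hs => ?_).trans_eq (by simp; ring)
    refine (norm_feedbackField_le B hl.le _).trans ?_
    calc _ ≤ lam * ‖B‖ * (‖B‖ * ‖z₀‖) := by
          gcongr
          exact (normalizedPairing_le B _).trans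
            (mul_le_mul_of_nonneg_left (hz.norm_le hS hB hl.le hs.1) (norm_nonneg _))
      _ = _ := by ring
  set I := ∫ s in (0 : ℝ)..T, normalizedPairing B (z (max s 0))
  set E := ∫ s in (0 : ℝ)..T, normalizedPairing B (z (max s 0)) ^ 2
  set η := lam * ‖B‖ ^ 2 * T
  have hη0 : 0 ≤ η := by positivity
  set K := gainConst ‖B‖ T lam
  have hK : η ≤ K := le_gainConst _ _ _
  have hC1 : 0 < obsConst ‖B‖ C T ^ 2 := by rw [obsConst_sq hT.le]; positivity
  set κ := lam * δ ^ 2 / (4 * obsConst ‖B‖ C T ^ 2) with hκ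
  have hκ0 : 0 < κ := by positivity
  have h1 : δ ^ 2 * ‖S T z₀‖ ^ 4 ≤ ‖z₀‖ ^ 2 * obsConst ‖B‖ C T ^ 2 * E := by
    calc _ = (δ * ‖S T z₀‖ ^ 2) ^ 2 := by ring
      _ ≤ (‖z₀‖ * (1 + C * ‖B‖) * I) ^ 2 := pow_le_pow_left₀ (by positivity) hobs 2
      _ = (‖z₀‖ * (1 + C * ‖B‖)) ^ 2 * I ^ 2 := by ring
      _ ≤ (‖z₀‖ * (1 + C * ‖B‖)) ^ 2 * (T * E) := by gcongr
      _ = _ := by rw [obsConst_sq hT.le]; ring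
  have h2 : 8 * κ * ‖S T z₀‖ ^ 4 ≤ ‖z₀‖ ^ 2 * (2 * lam * E) := by
    have : 8 * κ * ‖S T z₀‖ ^ 4 =
        2 * lam / obsConst ‖B‖ C T ^ 2 * (δ ^ 2 * ‖S T z₀‖ ^ 4) := by
      rw [hκ]; field_simp; ring
    rw [this]
    calc _ ≤ 2 * lam / obsConst ‖B‖ C T ^ 2 * (‖z₀‖ ^ 2 * obsConst ‖B‖ C T ^ 2 * E) := by
          gcongr
      _ = _ := by
          have := hC1.ne'
          generalize obsConst ‖B‖ C T ^ 2 = c at this ⊢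
          field_simp
  have h3 : ‖z₀‖ ^ 2 * (2 * lam * E) ≤ ‖z₀‖ ^ 4 - ‖z T‖ ^ 4 := by
    have h4 : ‖z T‖ ^ 4 ≤ ‖z₀‖ ^ 2 * ‖z T‖ ^ 2 := by
      have := mul_le_mul_of_nonneg_right (pow_le_pow_left₀ (norm_nonneg _)
        (hz.norm_le hS hB hl.le hT.le) 2) (sq_nonneg ‖z T‖)
      linarith [this, show ‖z T‖ ^ 2 * ‖z T‖ ^ 2 = ‖z T‖ ^ 4 by ring]
    have h5 := mul_le_mul_of_nonneg_left hen (sq_nonneg ‖z₀‖)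
    linarith [show ‖z₀‖ ^ 2 * ‖z₀‖ ^ 2 = ‖z₀‖ ^ 4 by ring]
  have h6 : ‖z T‖ ^ 4 ≤ 8 * ‖S T z₀‖ ^ 4 + K * ‖z₀‖ ^ 4 := by
    have h7 : ‖z T‖ ≤ ‖S T z₀‖ + η * ‖z₀‖ := by
      have := norm_sub_norm_le (z T) (S T z₀)
      linarith
    have h8 := (pow_le_pow_left₀ (norm_nonneg _) h7 4).trans (add_pow_four_le _ _)
    -- `η ≤ 1/2` gives `8η³ ≤ 1`, hence `8η⁴ ≤ η ≤ K`.
    have h9 : 8 * η ^ 4 ≤ K := by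
      have : η ^ 3 ≤ (1 / 2) ^ 3 := pow_le_pow_left₀ hη0 hlB 3
      have := mul_le_mul_of_nonneg_left this hη0
      linarith [show η * η ^ 3 = η ^ 4 by ring]
    have := mul_le_mul_of_nonneg_right h9 (pow_nonneg (norm_nonneg z₀) 4)
    rw [mul_pow] at h8
    linarith
  -- Adding `8κ ‖S(T) z₀‖⁴ ≤ ‖z₀‖⁴ - ‖z(T)‖⁴` cancels the free orbit and leaves `(1 + κ) ‖z(T)‖⁴ ≤
  -- (1 + κK) ‖z₀‖⁴`.
  have h10 := mul_le_mul_of_nonneg_left h6 hκ0.le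
  have h11 : decayRatio ‖B‖ C T δ lam = (1 + κ * K) / (1 + κ) := rfl
  rw [h11, div_mul_eq_mul_div, le_div_iff₀ (by positivity)]
  linarith

theorem decayRatio_mem_Ioo {b : ℝ} (hb : 0 ≤ b) (hC : 0 < C) (hT : 0 < T) (hδ : 0 < δ)
    (hl : 0 < lam) (hlB : lam * b ^ 2 * T ≤ 1 / 2) : decayRatio b C T δ lam ∈ Ioo (0 : ℝ) 1 := by
  have hC1 : 0 < obsConst b C T ^ 2 := by rw [obsConst_sq hT.le]; positivity
  have hK0 : 0 ≤ gainConst b T lam := le_trans (by positivity) (le_gainConst b T lam)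
  -- The exponent is at most `1/2 < log 2`.
  have hK1 : gainConst b T lam < 1 := by
    have h1 : Real.exp (lam * b ^ 2 * T) < Real.exp (Real.log 2) :=
      Real.exp_lt_exp.2 (by linarith [Real.log_two_gt_d9])
    rw [Real.exp_log two_pos] at h1
    unfold gainConst; linarith
  have hκ0 : 0 < lam * δ ^ 2 / (4 * obsConst b C T ^ 2) := by positivity
  refine ⟨by unfold decayRatio; positivity, ?_⟩
  rw [decayRatio, div_lt_one (by positivity)]
  have := mul_lt_mul_of_pos_left hK1 hκ0
  linarith

theorem IsSemilinearSolution.norm_le_exp [CompleteSpace X] (hS : IsContractionSemigroup S)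
    (hB : PairingLipschitz B 𝒦 C) (hl : 0 ≤ lam) (hT : 0 < T) {ζ : ℝ} (hζ : ζ ∈ Ioo (0 : ℝ) 1)
    (hstep : ∀ (z₀ : X) (z : ℝ → X), IsSemilinearSolution S (feedbackField B lam) z₀ z →
      ‖z T‖ ^ 4 ≤ ζ * ‖z₀‖ ^ 4)
    {z₀ : X} {z : ℝ → X} (hz : IsSemilinearSolution S (feedbackField B lam) z₀ z) {t : ℝ}
    (ht : 0 ≤ t) :
    ‖z t‖ ≤ ζ ^ (-(1 / 4) : ℝ) * Real.exp (-(-Real.log ζ / (4 * T)) * t) * ‖z₀‖ := by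
  obtain ⟨L, hL⟩ := hB.exists_lipschitzWith hl
  have hiter : ∀ n : ℕ, ‖z (n * T)‖ ^ 4 ≤ ζ ^ n * ‖z₀‖ ^ 4 := fun n => by
    induction n with
    | zero => simp [hz.apply_zero hS]
    | succ n ih =>
      have h1 := hstep _ _ (hz.comp_add hS hL.continuous (t₀ := n * T) (by positivity))
      rw [Nat.cast_succ, add_one_mul, pow_succ' ζ, mul_assoc]
      exact h1.trans (mul_le_mul_of_nonneg_left ih hζ.1.le)
  set n := ⌊t / T⌋₊
  have hn : n * T ≤ t := by
    rw [← le_div_iff₀ hT]; exact Nat.floor_le (by positivity)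
  have hn' : t / T - 1 ≤ n := by
    have := Nat.lt_floor_add_one (t / T)
    linarith
  have h2 : ‖z t‖ ≤ ‖z (n * T)‖ := by
    have := (hz.comp_add hS hL.continuous (t₀ := n * T) (by positivity)).norm_le hS hB hl
      (sub_nonneg.2 hn)
    simpa using this
  -- The claimed bound is `ζ^{(t/T - 1)/4}`: the factor `ζ^{-1/4}` pays for the incomplete last
  -- period, during which the norm does not grow.
  have h3 : ζ ^ (-(1 / 4) : ℝ) * Real.exp (-(-Real.log ζ / (4 * T)) * t) =
      Real.exp (Real.log ζ * ((t / T - 1) / 4)) := by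
    rw [Real.rpow_def_of_pos hζ.1, ← Real.exp_add]
    congr 1
    field_simp
    ring
  rw [h3]
  refine (pow_le_pow_iff_left₀ (norm_nonneg _) (by positivity) four_ne_zero).1 ?_
  calc _ ≤ ‖z (n * T)‖ ^ 4 := pow_le_pow_left₀ (norm_nonneg _) h2 4
    _ ≤ ζ ^ n * ‖z₀‖ ^ 4 := hiter n
    _ ≤ Real.exp (Real.log ζ * ((t / T - 1) / 4)) ^ 4 * ‖z₀‖ ^ 4 := by
        gcongr
        rw [← Real.exp_nat_mul, ← Real.rpow_natCast, Real.rpow_def_of_pos hζ.1, Real.exp_le_exp]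
        have := mul_le_mul_of_nonpos_left hn' (Real.log_nonpos hζ.1.le hζ.2.le)
        push_cast
        linarith
    _ = _ := by ring

theorem isClosedLoopSolution_iff (hS : IsContractionSemigroup S)
    (hB : PairingLipschitz B 𝒦 C) (hl : 0 ≤ lam) {z₀ : X} {z : ℝ → X} :
    IsClosedLoopSolution S B (feedback B lam) z₀ z ↔
      IsSemilinearSolution S (feedbackField B lam) z₀ z := by
  obtain ⟨L, hL⟩ := hB.exists_lipschitzWith hl
  have heq : ∀ t, 0 ≤ t → EqOn
      (fun s => S (max (t - s) 0) (feedbackField B lam (z (max s 0))))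
      (fun s => feedback B lam (z s) • S (t - s) (B (z s))) (uIcc 0 t) := fun t ht s hs => by
    rw [uIcc_of_le ht] at hs
    simp only [feedbackField, max_eq_left hs.1, max_eq_left (sub_nonneg.2 hs.2), map_smul]
  have hI : ∀ t, 0 ≤ t → duhamel S (fun s => feedbackField B lam (z (max s 0))) t =
      ∫ s in (0 : ℝ)..t, feedback B lam (z s) • S (t - s) (B (z s)) := fun t ht =>
    intervalIntegral.integral_congr (heq t ht)
  constructor
  · intro h
    exact ⟨h.continuousOn, fun t ht => by rw [hI t ht]; exact h.formula t ht⟩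
  · intro h
    refine ⟨h.continuousOn, fun t ht => ?_, fun t ht => by rw [← hI t ht]; exact h.formula t ht⟩
    refine IntervalIntegrable.congr ((heq t ht).mono uIoc_subset_uIcc) ?_
    exact (hS.continuous_apply (by fun_prop)
      (hL.continuous.comp h.continuous_max)).intervalIntegrable _ _

end Decay

end BilinearStabilization

theorem mainTheorem2 {X : Type*} [NormedAddCommGroup X] [NormedSpace ℝ X] [CompleteSpace X]
    (A : X →ₗ.[ℝ] X) (S : ℝ → X →L[ℝ] X) (B : X →L[ℝ] X)
    (𝒦 : ℝ≥0 → ℝ≥0 → ℝ≥0) (C T δ : ℝ)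
    (hA1 : BilinearStabilization.GeneratesContractionSemigroup A S)
    (hA2 : BilinearStabilization.PairingLipschitz B 𝒦 C)
    (hA3 : BilinearStabilization.Observation S B T δ) :
    ∃ lam₀ : ℝ, 0 < lam₀ ∧ ∀ lam : ℝ, 0 < lam → lam < lam₀ →
      BilinearStabilization.decayRatio ‖B‖ C T δ lam ∈ Set.Ioo (0 : ℝ) 1 ∧
      BilinearStabilization.UniformlyExponentiallyStabilizes S B
        (BilinearStabilization.feedback B lam)
        (BilinearStabilization.decayRatio ‖B‖ C T δ lam ^ (-(1 / 4) : ℝ))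
        (-Real.log (BilinearStabilization.decayRatio ‖B‖ C T δ lam) / (4 * T)) := by
  open BilinearStabilization in
  have hT := hA3.pos_T
  have hS : IsContractionSemigroup S := ⟨hA1.semigroup, hA1.contraction⟩
  -- The first bound gives `λT ≤ 1`, the second `λ‖B‖²T ≤ 1/2`; the `+ 1` keeps the denominator
  -- positive when `B = 0`.
  refine ⟨min (1 / T) (1 / (2 * (‖B‖ ^ 2 * T + 1))), by positivity, fun lam hl hlt => ?_⟩
  have hlT : lam * T ≤ 1 :=
    (le_div_iff₀ hT).1 (hlt.le.trans (min_le_left _ _))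
  have hlB : lam * ‖B‖ ^ 2 * T ≤ 1 / 2 := by
    have := (le_div_iff₀ (by positivity)).1 (hlt.le.trans (min_le_right _ _))
    linarith
  have hζ := decayRatio_mem_Ioo (norm_nonneg B) hA2.pos hT hA3.pos_δ hl hlB
  obtain ⟨L, hL⟩ := hA2.exists_lipschitzWith hl.le
  refine ⟨hζ, Real.rpow_pos_of_pos hζ.1 _,
    div_pos (neg_pos.2 (Real.log_neg hζ.1 hζ.2)) (by positivity), fun z₀ => ?_⟩
  simp only [isClosedLoopSolution_iff hS hA2 hl.le]
  exact ⟨exists_isSemilinearSolution hS hL (feedbackField_zero B lam) z₀,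
    fun z w hz hw => hz.unique hS hL hw,
    fun z hz t ht => hz.norm_le_exp hS hA2 hl.le hT hζ
      (fun z₀ z hz => hz.norm_pow_four_le hS hA2 hA3 hl hlT hlB) ht⟩
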